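/- Fix a $p$-bit number format: a set of at most $2^p$ reals with a rounding map onto it that fixes each of its elements. A \emph{self-attention unit} is given by matrices $K,Q,V\in\mathbb{R}^{d\times D}$; on a token sequence $x_1,\dots,x_N\in\mathbb{R}^D$ its output at position $i$ is $y_i=\frac{\sum_{j=1}^{N}\exp(x_i^\top Q^\top Kx_j)\,Vx_j}{\sum_{j=1}^{N}\exp(x_i^\top Q^\top Kx_j)}\in\mathbb{R}^d$, where the result of every arithmetic operation is rounded to the format and sums are accumulated from left to right. An \emph{$H$-headed Transformer layer} of dimension $d$ and precision $p$ consists of $H$ such units and an arbitrary function $\Phi:(\mathbb{R}^d)^H\to\mathbb{R}^D$, and its output token at position $i$ is $\Phi(y_{i,1},\dots,y_{i,H})$. In one \emph{chain-of-thought step} the layer's output token at the last position is appended to the sequence. The \emph{$k$-iterated function composition problem} with domain size $n$ is to compute $f^{(k)}(x)=f(f(\cdots f(x)))$ for $f:[n]\to[n]$ and $x\in[n]$; a prompt consists of a finite list of tokens for each $i=1,\dots,n$ in order, determined by $i$ and $f(i)$, followed by a nonempty finite list of tokens determined by $x$. The layer solves the problem within $R$ steps if, for some such encoding and some rule that reads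 the token generated at step $t$ either as an answer or as ``continue'', on every prompt the first answer appears at some step $t$ with $1\le t\le R$ and equals $f^{(k)}(x)$. \textbf{Theorem.} There is an absolute constant $c>0$ such that for all integers $n,H,d,p\ge 1$, with $k=\left\lceil \tfrac{1}{100}\sqrt{n/(Hdp)}\right\rceil$, every $H$-headed Transformer layer with dimension $d$ and precision $p$ (for any token dimension $D$ and any $p$-bit number format) that solves the $k$-iterated function composition problem with domain size $n$ within $R$ chain-of-thought steps satisfies $$R\ \ge\ c\,\sqrt{\frac{n}{Hdp}}.$$ In other words, $\Omega\big(\sqrt{n/(Hdp)}\big)$ chain-of-thought steps are required. -/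

import Mathlib

namespace CoT

/-- A `p`-bit number format: a set of at most `2 ^ p` representable reals together with a rounding
map onto it that leaves representable numbers unchanged. Fixed-point and floating-point formats,
with any rounding and overflow convention, are instances. -/
structure NumberFormat (p : ℕ) where
  values : Finset ℝ
  card_values_le : values.card ≤ 2 ^ p
  round : ℝ → ℝ
  round_mem : ∀ a, round a ∈ values
  round_of_mem : ∀ a ∈ values, round a = a

/-- Tokens are vectors in `ℝ^D`. -/
abbrev Token (D : ℕ) := Fin D → ℝ

/-- A self-attention unit: key, query and value matrices in `ℝ^{d × D}`. -/
structure AttentionUnit (D d : ℕ) where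
  key : Matrix (Fin d) (Fin D) ℝ
  query : Matrix (Fin d) (Fin D) ℝ
  value : Matrix (Fin d) (Fin D) ℝ

/-- An `H`-headed transformer layer: `H` self-attention units and an arbitrary combining function,
which maps the `H` outputs at a position to an output token. -/
structure Layer (H D d : ℕ) where
  head : Fin H → AttentionUnit D d
  combine : (Fin H → Fin d → ℝ) → Token D

section Arithmetic

variable {p : ℕ} (F : NumberFormat p)

/-- Sum of a list of reals, accumulated from left to right and rounded after every addition. -/
noncomputable def roundedSum (l : List ℝ) : ℝ :=
  l.foldl (fun acc a => F.round (acc + a)) 0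

/-- Inner product in which every multiplication and every addition is rounded. -/
noncomputable def roundedDot {m : ℕ} (u v : Fin m → ℝ) : ℝ :=
  roundedSum F (List.ofFn fun k => F.round (u k * v k))

/-- Matrix-vector product in which every multiplication and every addition is rounded. -/
noncomputable def roundedMulVec {m k : ℕ} (M : Matrix (Fin m) (Fin k) ℝ) (v : Fin k → ℝ) :
    Fin m → ℝ :=
  fun i => roundedDot F (M i) v

end Arithmetic

section Attention

variable {p D d H : ℕ} (F : NumberFormat p)

/-- The unnormalized attention weight `exp (xᵀ Qᵀ K z)` which a position holding `x` gives to a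
position holding `z`, computed in the format `F`. -/
noncomputable def AttentionUnit.weight (A : AttentionUnit D d) (x z : Token D) : ℝ :=
  F.round (Real.exp (roundedDot F (roundedMulVec F A.query x) (roundedMulVec F A.key z)))

/-- Output of a self-attention unit on the token sequence `X`, at a position holding the token `x`:
`(∑ⱼ exp (xᵀ Qᵀ K Xⱼ) V Xⱼ) / (∑ⱼ exp (xᵀ Qᵀ K Xⱼ))`, with every arithmetic operation carried out in
the format `F` and both sums accumulated along the sequence. -/
noncomputable def AttentionUnit.output (A : AttentionUnit D d) (X : List (Token D)) (x : Token D) :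
    Fin d → ℝ :=
  fun c => F.round
    (roundedSum F (X.map fun z => F.round (A.weight F x z * roundedMulVec F A.value z c)) /
      roundedSum F (X.map fun z => A.weight F x z))

/-- Output token of the layer on the sequence `X`, at a position holding the token `x`. -/
noncomputable def Layer.output (L : Layer H D d) (X : List (Token D)) (x : Token D) : Token D :=
  L.combine fun h => (L.head h).output F X x

/-- The state of a chain of thought: `(Y, y)` stands for the nonempty token sequence `Y ++ [y]`.
Starting from a prompt, each chain-of-thought step appends to the sequence the output token of the
layer at the last position; `L.chain F P t` is the sequence after `t` steps. -/
noncomputable def Layer.chain (L : Layer H D d) (P : List (Token D) × Token D) :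
    ℕ → List (Token D) × Token D
  | 0 => P
  | t + 1 =>
    let s := L.chain P t
    (s.1 ++ [s.2], L.output F (s.1 ++ [s.2]) s.2)

end Attention

/-- A way of writing instances of the iterated composition problem on the domain `Fin n` as
prompts: the tokens that state that the value at `i` is `j`, and the tokens of the query about `x`,
the last of which is `lastToken x`. -/
structure PromptFormat (n D : ℕ) where
  entry : Fin n → Fin n → List (Token D)
  query : Fin n → List (Token D)
  lastToken : Fin n → Token D

/-- The prompt that lists all values of `f` and ends in the query about `x`. -/
def PromptFormat.prompt {n D : ℕ} (E : PromptFormat n D) (f : Fin n → Fin n) (x : Fin n) :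
    List (Token D) × Token D :=
  ((List.ofFn fun i => E.entry i (f i)).flatten ++ E.query x, E.lastToken x)

/-- The layer `L`, computing in the format `F`, solves the `K`-fold iterated composition problem on
`Fin n` within `R` chain-of-thought steps: on every prompt, the chain ends after some `t` steps,
`1 ≤ t ≤ R`, with the correct answer `f^[K] x`. The rule `readout t` reads the token generated in
step `t` as an answer, or as `none` when the chain goes on; it covers both a number of steps fixed
in advance and generation until an answer token appears. -/
def SolvesIterated {p n H D d : ℕ} (F : NumberFormat p) (L : Layer H D d) (E : PromptFormat n D)
    (readout : ℕ → Token D → Option (Fin n)) (K R : ℕ) : Prop :=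
  ∀ (f : Fin n → Fin n) (x : Fin n), ∃ t : ℕ, 1 ≤ t ∧ t ≤ R ∧
    readout t (L.chain F (E.prompt f x) t).2 = some (f^[K] x) ∧
    ∀ s : ℕ, 1 ≤ s → s < t → readout s (L.chain F (E.prompt f x) s).2 = none

end CoT

/-! The proof reduces pointer chasing to the layer. Split the domain into halves that `f` maps to
each other by `g false` and `g true`; iterating `f` then chases a pointer alternately through the
two. A prompt is a block for `g false`, a block for `g true` and a common tail. With left-to-right
rounded sums, a chain-of-thought step is one pass with a memory of `B = H(d+1)(p+1)` bits, so `R`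
steps are a protocol of `2R` messages (`Layer.publicState_eq_chain`). The owner of `g false` speaks
first although the chase starts with `g true`, so the speaker is always the party that does not own
the next pointer value.

An adversary (`exists_rectangle`) keeps a rectangle of inputs with the same transcript and the same
pointer. A message costs `B` bits of density; frequent values are then fixed until the speaker's
side is spread, and the other side reveals a pointer that avoids the fixed coordinates. While `B`
times the number of rounds is small compared to `m`, the next pointer value stays undetermined
(`exists_publicState_eq_chase_ne`). -/

namespace CoT

/-! ### Density and spread of sets of functions -/

section Adversary

variable {m : ℕ}

/-- The members of `X` agree on the coordinates in `J`, and `X` falls short of the expected size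
`m ^ (m - |J|)` by a factor of at most `2 ^ (L - |J|)`. -/
structure Dense (L : ℕ) (J : Finset (Fin m)) (X : Finset (Fin m → Fin m)) : Prop where
  agree : ∀ f ∈ X, ∀ g ∈ X, ∀ i ∈ J, f i = g i
  card_le : 2 ^ J.card * m ^ m ≤ X.card * 2 ^ L * m ^ J.card

/-- No value at a coordinate outside `J` is taken by more than a `2 / m` fraction of `X`. -/
def Spread (J : Finset (Fin m)) (X : Finset (Fin m → Fin m)) : Prop :=
  ∀ i ∉ J, ∀ v, m * (X.filter fun f => f i = v).card ≤ 2 * X.card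

/-- Overwriting the common values on `J` arbitrarily produces distinct functions from distinct
pairs. -/
theorem card_mul_pow_le_of_agree {J : Finset (Fin m)} {X : Finset (Fin m → Fin m)}
    (h : ∀ f ∈ X, ∀ g ∈ X, ∀ i ∈ J, f i = g i) : X.card * m ^ J.card ≤ m ^ m := by
  classical
  have hinj : Function.Injective
      (fun q : X × (J → Fin m) => fun i => if hi : i ∈ J then q.2 ⟨i, hi⟩ else q.1.1 i) := by
    rintro ⟨⟨f, hf⟩, u⟩ ⟨⟨g, hg⟩, w⟩ hq
    have hq' := fun i => congrFun hq i
    simp only at hq'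
    refine Prod.ext (Subtype.ext (funext fun i => ?_)) (funext fun i => ?_)
    · by_cases hi : i ∈ J
      · exact h f hf g hg i hi
      · simpa [hi] using hq' i
    · simpa [i.2] using hq' i
  simpa using Fintype.card_le_of_injective _ hinj

namespace Dense

variable {L : ℕ} {J : Finset (Fin m)} {X : Finset (Fin m → Fin m)}

theorem mono {L' : ℕ} (h : Dense L J X) (hL : L ≤ L') : Dense L' J X :=
  ⟨h.agree, h.card_le.trans (by gcongr; norm_num)⟩

theorem card_pos (hm : 0 < m) (h : Dense L J X) : 0 < X.card := by
  rcases Nat.eq_zero_or_pos X.card with h0 | h0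
  · have := h.card_le
    rw [h0, zero_mul, zero_mul] at this
    have : 0 < 2 ^ J.card * m ^ m := by positivity
    omega
  · exact h0

theorem card_fixed_le (hm : 0 < m) (h : Dense L J X) : J.card ≤ L := by
  have h1 := h.card_le
  have h2 := card_mul_pow_le_of_agree h.agree
  have h3 : 2 ^ J.card * m ^ m ≤ 2 ^ L * m ^ m := by
    calc _ ≤ _ := h1
      _ = 2 ^ L * (X.card * m ^ J.card) := by ring
      _ ≤ _ := by gcongr
  exact (Nat.pow_le_pow_iff_right (by norm_num)).1 (Nat.le_of_mul_le_mul_right h3 (by positivity))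

/-- A new fixed coordinate divides the expected size by `m` and, through `2 ^ |J|`, calls for twice
the relative density. A value with a `2 / m` share supplies exactly that, so `L' = L` is possible;
this is what bounds the number of fixed coordinates by `L`. -/
theorem fix_coordinate {L' : ℕ} (h : Dense L J X) {i : Fin m} (hi : i ∉ J) {v : Fin m}
    (hc : 2 * 2 ^ L * X.card ≤ m * 2 ^ L' * (X.filter fun f => f i = v).card) :
    Dense L' (insert i J) (X.filter fun f => f i = v) := by
  refine ⟨fun f hf g hg j hj => ?_, ?_⟩
  · rw [Finset.mem_filter] at hf hg
    rcases Finset.mem_insert.1 hj with rfl | hj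
    · rw [hf.2, hg.2]
    · exact h.agree f hf.1 g hg.1 j hj
  · rw [Finset.card_insert_of_notMem hi]
    calc 2 ^ (J.card + 1) * m ^ m = 2 * (2 ^ J.card * m ^ m) := by ring
      _ ≤ 2 * (X.card * 2 ^ L * m ^ J.card) := Nat.mul_le_mul_left _ h.card_le
      _ = (2 * 2 ^ L * X.card) * m ^ J.card := by ring
      _ ≤ (m * 2 ^ L' * (X.filter fun f => f i = v).card) * m ^ J.card :=
        Nat.mul_le_mul_right _ hc
      _ = _ := by ring

/-- Fixing the coordinates at which some value is too frequent makes a dense set spread. -/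
theorem exists_spread (h : Dense L J X) :
    ∃ J' X', X' ⊆ X ∧ Dense L J' X' ∧ Spread J' X' := by
  induction hk : Jᶜ.card using Nat.strong_induction_on generalizing J X with
  | _ k ih =>
    by_cases hs : Spread J X
    · exact ⟨J, X, Finset.Subset.refl _, h, hs⟩
    · unfold Spread at hs
      push Not at hs
      obtain ⟨i, hi, v, hv⟩ := hs
      have h' : Dense L (insert i J) (X.filter fun f => f i = v) :=
        h.fix_coordinate hi (by
          calc 2 * 2 ^ L * X.card = 2 ^ L * (2 * X.card) := by ring
            _ ≤ 2 ^ L * (m * (X.filter fun f => f i = v).card) := Nat.mul_le_mul_left _ hv.le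
            _ = _ := by ring)
      have hlt : (insert i J)ᶜ.card < k := by
        rw [← hk]
        apply Finset.card_lt_card
        rw [Finset.compl_insert]
        exact Finset.erase_ssubset (Finset.mem_compl.2 hi)
      obtain ⟨J', X', hX, hD, hS⟩ := ih _ hlt h' rfl
      exact ⟨J', X', hX.trans (Finset.filter_subset _ _), hD, hS⟩

/-- The value at a free coordinate of a spread set can be fixed outside of any small set `S`. -/
theorem exists_reveal (hm : 0 < m) (h : Dense L J X) (hs : Spread J X) {i : Fin m} (hi : i ∉ J)
    {S : Finset (Fin m)} (hS : 4 * S.card ≤ m) :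
    ∃ w ∉ S, Dense (L + 2) (insert i J) (X.filter fun f => f i = w) := by
  by_contra! hcon
  -- A share of `1 / (2m)` is a factor 4 below the `2 / m` that costs nothing, hence `L + 2`.
  have hsmall : ∀ w ∉ S, 2 * (m * (X.filter fun f => f i = w).card) + 1 ≤ X.card := by
    intro w hw
    by_contra! hlt
    refine hcon w hw (h.fix_coordinate hi ?_)
    calc 2 * 2 ^ L * X.card ≤ 2 * 2 ^ L * (2 * (m * (X.filter fun f => f i = w).card)) :=
          Nat.mul_le_mul_left _ (by omega)
      _ = _ := by ring
  have hsum : ∑ w : Fin m, (X.filter fun f => f i = w).card = X.card :=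
    (Finset.card_eq_sum_card_fiberwise fun _ _ => Finset.mem_coe.2 (Finset.mem_univ _)).symm
  -- By spread, values in `S` account for at most half of `X`; values outside account for strictly
  -- less than half, a contradiction.
  have h1 : ∑ w ∈ S, 2 * (m * (X.filter fun f => f i = w).card) ≤ S.card * (4 * X.card) := by
    rw [← smul_eq_mul]
    exact Finset.sum_le_card_nsmul _ _ _ fun w _ => by linarith [hs i hi w]
  have h2 : ∑ w ∈ Sᶜ, (2 * (m * (X.filter fun f => f i = w).card) + 1) ≤ Sᶜ.card * X.card := by
    rw [← smul_eq_mul]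
    exact Finset.sum_le_card_nsmul _ _ _ fun w hw => hsmall w (Finset.mem_compl.1 hw)
  have h3 := Finset.sum_add_sum_compl S fun w => 2 * (m * (X.filter fun f => f i = w).card)
  rw [← Finset.mul_sum (s := Finset.univ), ← Finset.mul_sum (s := Finset.univ), hsum] at h3
  rw [Finset.sum_add_distrib, Finset.sum_const, smul_eq_mul, mul_one] at h2
  have hc : S.card + Sᶜ.card = m := by simp
  have hpos : 0 < Sᶜ.card := by omega
  have h4 : 4 * S.card * X.card ≤ m * X.card := Nat.mul_le_mul_right _ hS
  have h5 : Sᶜ.card * X.card ≤ m * X.card := Nat.mul_le_mul_right _ (by omega)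
  nlinarith

/-- Some message of `B` bits is sent by a large part of a dense set. -/
theorem exists_message {σ : Type*} [Fintype σ] [DecidableEq σ] {B : ℕ}
    (hσ : Fintype.card σ ≤ 2 ^ B) (hm : 0 < m) (h : Dense L J X) (φ : (Fin m → Fin m) → σ) :
    ∃ c, Dense (L + B) J (X.filter fun f => φ f = c) := by
  obtain ⟨f₀, -⟩ := Finset.card_pos.1 (h.card_pos hm)
  have : Nonempty σ := ⟨φ f₀⟩
  have hsum : ∑ c : σ, (X.filter fun f => φ f = c).card = X.card :=
    (Finset.card_eq_sum_card_fiberwise fun _ _ => Finset.mem_coe.2 (Finset.mem_univ _)).symm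
  obtain ⟨c, -, hc⟩ := Finset.exists_max_image Finset.univ
    (fun c => (X.filter fun f => φ f = c).card) Finset.univ_nonempty
  have hle : X.card ≤ 2 ^ B * (X.filter fun f => φ f = c).card := by
    rw [← hsum]
    refine (Finset.sum_le_card_nsmul _ _ _ hc).trans ?_
    rw [smul_eq_mul, Finset.card_univ]
    exact Nat.mul_le_mul_right _ hσ
  refine ⟨c, fun f hf g hg => h.agree f (Finset.filter_subset _ _ hf) g
    (Finset.filter_subset _ _ hg), h.card_le.trans ?_⟩
  calc X.card * 2 ^ L * m ^ J.card
      ≤ (2 ^ B * (X.filter fun f => φ f = c).card) * 2 ^ L * m ^ J.card := by gcongr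
    _ = _ := by ring

end Dense

theorem dense_univ (L : ℕ) : Dense L (∅ : Finset (Fin m)) Finset.univ := by
  refine ⟨by simp, ?_⟩
  simp only [Finset.card_empty, pow_zero, Finset.card_univ, Fintype.card_fun, Fintype.card_fin]
  nlinarith [Nat.one_le_two_pow (n := L), Nat.zero_le (m ^ m)]

theorem spread_univ : Spread (∅ : Finset (Fin m)) Finset.univ := by
  intro i _ v
  have hagree : ∀ f ∈ Finset.univ.filter (fun f : Fin m → Fin m => f i = v),
      ∀ g ∈ Finset.univ.filter (fun f : Fin m → Fin m => f i = v), ∀ j ∈ ({i} : Finset (Fin m)),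
        f j = g j := by
    intro f hf g hg j hj
    rw [Finset.mem_singleton.1 hj, (Finset.mem_filter.1 hf).2, (Finset.mem_filter.1 hg).2]
  have := card_mul_pow_le_of_agree hagree
  simp only [Finset.card_singleton, pow_one] at this
  simp only [Finset.card_univ, Fintype.card_fun, Fintype.card_fin]
  nlinarith

theorem Spread.exists_ne (hm : 2 < m) {J : Finset (Fin m)} {X : Finset (Fin m → Fin m)}
    (hX : 0 < X.card) (h : Spread J X) {i : Fin m} (hi : i ∉ J) :
    ∃ f ∈ X, ∃ g ∈ X, f i ≠ g i := by
  obtain ⟨f, hf⟩ := Finset.card_pos.1 hX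
  by_contra! hcon
  have hall : X.filter (fun g => g i = f i) = X :=
    Finset.filter_true_of_mem fun g hg => (hcon f hf g hg).symm
  have := h i hi (f i)
  rw [hall] at this
  nlinarith

end Adversary

/-! ### Lower bound for two-party pointer chasing -/

section PointerChasing

variable {m : ℕ}

/-- Pointer chasing through two functions, used alternately and starting with `g true`. -/
def chase (x₀ : Fin m) (g : Bool → Fin m → Fin m) : ℕ → Fin m
  | 0 => x₀
  | r + 1 => g (!r.bodd) (chase x₀ g r)

variable {σ κ : Type*}

/-- The public state of a two-party protocol in which the owners of `g false` and `g true` speak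
alternately, starting with `g false`. -/
def publicState (msg : κ → (Fin m → Fin m) → σ) (upd : κ → σ → κ) (s₀ : κ)
    (g : Bool → Fin m → Fin m) : ℕ → κ
  | 0 => s₀
  | r + 1 => upd (publicState msg upd s₀ g r) (msg (publicState msg upd s₀ g r) (g r.bodd))

variable [Fintype σ] {B : ℕ} (msg : κ → (Fin m → Fin m) → σ) (upd : κ → σ → κ) (s₀ : κ)
  (x₀ : Fin m)

/-- The invariant of the adversary: the owner `!r.bodd` of the next value has a spread set in which
the coordinate `v` is free, while the next speaker `r.bodd` need only be dense. -/
theorem exists_rectangle (hm : 0 < m) (hσ : Fintype.card σ ≤ 2 ^ B) (r : ℕ)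
    (hr : 4 * ((B + 2) * r) ≤ m) :
    ∃ (X : Bool → Finset (Fin m → Fin m)) (J : Bool → Finset (Fin m)) (s : ℕ → κ) (v : Fin m),
      (∀ b, Dense ((B + 2) * r) (J b) (X b)) ∧ Spread (J !r.bodd) (X !r.bodd) ∧ v ∉ J (!r.bodd) ∧
      ∀ g : Bool → Fin m → Fin m, (∀ b, g b ∈ X b) →
        (∀ i ≤ r, publicState msg upd s₀ g i = s i) ∧ chase x₀ g r = v := by
  classical
  induction r with
  | zero =>
    exact ⟨fun _ => Finset.univ, fun _ => ∅, fun _ => s₀, x₀, fun _ => dense_univ _, spread_univ,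
      Finset.notMem_empty _, fun g _ => ⟨fun i hi => by rw [Nat.le_zero.1 hi]; rfl, rfl⟩⟩
  | succ r ih =>
    have hmul : (B + 2) * (r + 1) = (B + 2) * r + B + 2 := by ring
    obtain ⟨X, J, s, v, hD, hS, hv, hg⟩ := ih (by omega)
    obtain ⟨c, hc⟩ := (hD r.bodd).exists_message hσ hm (msg (s r))
    obtain ⟨J', X', hX', hD', hS'⟩ := hc.exists_spread
    have hJ' := hD'.card_fixed_le hm
    -- The new pointer avoids `J'`, so it is a free coordinate of the speaker, who owns the next
    -- value. Here `|J'| ≤ (B + 2) * r + B` is at most `m / 4`.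
    obtain ⟨w, hw, hDw⟩ := (hD !r.bodd).exists_reveal hm hS hv (S := J') (by omega)
    refine ⟨fun b => if b = r.bodd then X' else (X !r.bodd).filter fun f => f v = w,
      fun b => if b = r.bodd then J' else insert v (J !r.bodd), fun i => if i ≤ r then s i else upd (s r) c, w,
      fun b => ?_, ?_, ?_,
      fun g hgX => ?_⟩
    · by_cases hb : b = r.bodd
      · simpa only [hb, if_true] using hD'.mono (by omega)
      · simpa only [hb, if_false] using hDw.mono (by omega)
    · simpa using hS'
    · simpa using hw
    · have h1 : g r.bodd ∈ X' := by simpa using hgX r.bodd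
      have h2 : g (!r.bodd) ∈ (X !r.bodd).filter fun f => f v = w := by simpa using hgX (!r.bodd)
      have h1' := Finset.mem_filter.1 (hX' h1)
      have h2' := Finset.mem_filter.1 h2
      obtain ⟨h3, h4⟩ := hg g fun b => by
        rcases Bool.eq_or_eq_not b r.bodd with rfl | rfl
        · exact h1'.1
        · exact h2'.1
      refine ⟨fun i hi => ?_, by rw [chase, h4, h2'.2]⟩
      dsimp only
      rcases Nat.le_succ_iff.1 hi with hi | rfl
      · rw [if_pos hi, h3 i hi]
      · rw [if_neg (by omega), publicState, h3 r le_rfl, h1'.2]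

/-- Some two inputs have the same public state after `r` messages, but different pointers after
`r + 1` steps. -/
theorem exists_publicState_eq_chase_ne (hm : 2 < m) (hσ : Fintype.card σ ≤ 2 ^ B) (r : ℕ)
    (hr : 4 * ((B + 2) * r) ≤ m) :
    ∃ g g' : Bool → Fin m → Fin m,
      (∀ i ≤ r, publicState msg upd s₀ g i = publicState msg upd s₀ g' i) ∧
      chase x₀ g (r + 1) ≠ chase x₀ g' (r + 1) := by
  obtain ⟨X, J, s, v, hD, hS, hv, hg⟩ :=
    exists_rectangle msg upd s₀ x₀ (by omega) hσ r hr
  obtain ⟨f, hf, f', hf', hne⟩ := hS.exists_ne hm ((hD _).card_pos (by omega)) hv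
  obtain ⟨u, hu⟩ := Finset.card_pos.1 ((hD r.bodd).card_pos (by omega))
  have hmem : ∀ q ∈ X (!r.bodd), ∀ b, (if b = r.bodd then u else q) ∈ X b := by
    intro q hq b
    rcases Bool.eq_or_eq_not b r.bodd with rfl | rfl
    · simpa using hu
    · simpa using hq
  obtain ⟨h1, h2⟩ := hg _ (hmem f hf)
  obtain ⟨h1', h2'⟩ := hg _ (hmem f' hf')
  refine ⟨_, _, fun i hi => (h1 i hi).trans (h1' i hi).symm, ?_⟩
  rw [chase, chase, h2, h2']
  simpa using hne

end PointerChasing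
-- Chain of thought as a two-party protocol
section Streaming

variable {p H D d : ℕ} (F : NumberFormat p) (L : Layer H D d)

/-- The memory of a layer that reads a sequence from left to right: the partial sums of the
denominator (`none`) and of the coordinates of the numerator of every head. -/
abbrev Accumulator (H d : ℕ) (F : NumberFormat p) :=
  Fin H → Option (Fin d) → ↥(insert 0 F.values : Finset ℝ)

/-- The exponent has `p + 1` because the initial value 0 need not belong to the format. -/
theorem card_accumulator_le : Fintype.card (Accumulator H d F) ≤ 2 ^ (H * (d + 1) * (p + 1)) := by
  have h : Fintype.card ↥(insert 0 F.values : Finset ℝ) ≤ 2 ^ (p + 1) := by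
    rw [Fintype.card_coe]
    have := F.card_values_le
    have := Finset.card_insert_le 0 F.values
    have := Nat.one_le_two_pow (n := p)
    rw [pow_succ]
    omega
  calc Fintype.card (Accumulator H d F)
      = Fintype.card ↥(insert 0 F.values : Finset ℝ) ^ (H * (d + 1)) := by
        rw [Fintype.card_fun, Fintype.card_fun, Fintype.card_option, Fintype.card_fin,
          Fintype.card_fin, ← pow_mul, mul_comm]
    _ ≤ (2 ^ (p + 1)) ^ (H * (d + 1)) := Nat.pow_le_pow_left h _
    _ = _ := by rw [← pow_mul, mul_comm]

/-- The summand that a position holding `z` adds to the partial sums of head `h`. -/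
noncomputable def Layer.summand (x z : Token D) (h : Fin H) : Option (Fin d) → ℝ
  | none => (L.head h).weight F x z
  | some c => F.round ((L.head h).weight F x z * roundedMulVec F (L.head h).value z c)

noncomputable def Layer.accumulate (x : Token D) (s : Accumulator H d F) (z : Token D) :
    Accumulator H d F :=
  fun h c => ⟨F.round (s h c + L.summand F x z h c), Finset.mem_insert_of_mem (F.round_mem _)⟩

noncomputable def Layer.finish (s : Accumulator H d F) : Token D :=
  L.combine fun h c => F.round (s h (some c) / s h none)

/-- The accumulator before the first token. -/
def emptyAccumulator : Accumulator H d F := fun _ _ => ⟨0, Finset.mem_insert_self _ _⟩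

theorem Layer.coe_foldl_accumulate (x : Token D) (X : List (Token D)) (s : Accumulator H d F)
    (h : Fin H) (c : Option (Fin d)) :
    ((X.foldl (L.accumulate F x) s h c : ↥(insert 0 F.values : Finset ℝ)) : ℝ) =
      (X.map fun z => L.summand F x z h c).foldl (fun acc a => F.round (acc + a)) (s h c) := by
  induction X generalizing s with
  | nil => rfl
  | cons z X ih => rw [List.foldl_cons, ih, List.map_cons, List.foldl_cons]; rfl

theorem Layer.output_eq_finish (X : List (Token D)) (x : Token D) :
    L.output F X x = L.finish F (X.foldl (L.accumulate F x) (emptyAccumulator F)) := by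
  unfold Layer.output Layer.finish
  congr 1
  funext h c
  rw [L.coe_foldl_accumulate, L.coe_foldl_accumulate]
  rfl

variable {m : ℕ} (block : Bool → (Fin m → Fin m) → List (Token D))

/-- The accumulator after the block of tokens of the party whose turn it is. The public state
consists of the common tail of the sequence, its last token, and the accumulator after the block
of the first party if that party has spoken. -/
noncomputable def Layer.message :
    (List (Token D) × Token D) × Option (Accumulator H d F) → (Fin m → Fin m) → Accumulator H d F
  | (s, none), f => (block false f).foldl (L.accumulate F s.2) (emptyAccumulator F)
  | (s, some q), f => (block true f).foldl (L.accumulate F s.2) q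

noncomputable def Layer.update :
    (List (Token D) × Token D) × Option (Accumulator H d F) → Accumulator H d F →
      (List (Token D) × Token D) × Option (Accumulator H d F)
  | (s, none), q => (s, some q)
  | (s, some _), q =>
    ((s.1 ++ [s.2], L.finish F ((s.1 ++ [s.2]).foldl (L.accumulate F s.2) q)), none)

/-- Two messages carry the accumulator across both blocks; the tail is public, so the next token can
be computed without further communication. -/
theorem Layer.publicState_eq_chain (T : List (Token D)) (y : Token D)
    (g : Bool → Fin m → Fin m) (t : ℕ) :
    ∃ T', (L.chain F (block false (g false) ++ block true (g true) ++ T, y) t).1 =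
        block false (g false) ++ block true (g true) ++ T' ∧
      publicState (L.message F block) (L.update F) ((T, y), none) g (2 * t) =
        ((T', (L.chain F (block false (g false) ++ block true (g true) ++ T, y) t).2), none) := by
  induction t with
  | zero => exact ⟨T, rfl, rfl⟩
  | succ t ih =>
    obtain ⟨T', h1, h2⟩ := ih
    set P := L.chain F (block false (g false) ++ block true (g true) ++ T, y) t with hP
    refine ⟨T' ++ [P.2], ?_, ?_⟩
    · rw [Layer.chain, ← hP, h1, List.append_assoc]
    · have hb : (2 * t).bodd = false := by simp
      have hb' : (2 * t + 1).bodd = true := by simp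
      rw [Layer.chain, ← hP, L.output_eq_finish, h1, mul_add, mul_one, publicState, publicState,
        h2, hb, hb']
      simp only [Layer.message, Layer.update, List.foldl_append]

end Streaming

/-! ### Pointer chasing as iterated composition -/

section Embedding

variable {m l : ℕ}

/-- The two halves of the domain. -/
def half (m l : ℕ) : Bool → Fin m → Fin (m + m + l)
  | false, i => Fin.castAdd l (Fin.castAdd m i)
  | true, i => Fin.castAdd l (Fin.natAdd m i)

/-- The function that maps the two halves of the domain to each other by `g`. -/
def swapHalves (l : ℕ) (g : Bool → Fin m → Fin m) : Fin (m + m + l) → Fin (m + m + l) :=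
  Fin.addCases
    (Fin.addCases (fun i => half m l true (g false i)) fun i => half m l false (g true i))
    (Fin.natAdd (m + m))

theorem half_injective (b : Bool) : Function.Injective (half m l b) := by
  intro i j h
  cases b <;> simpa [half, Fin.ext_iff] using h

theorem swapHalves_half (g : Bool → Fin m → Fin m) (b : Bool) (i : Fin m) :
    swapHalves l g (half m l b i) = half m l (!b) (g b i) := by
  cases b <;> simp only [swapHalves, half, Fin.addCases_left, Fin.addCases_right] <;> rfl

theorem iterate_swapHalves (g : Bool → Fin m → Fin m) (x₀ : Fin m) (r : ℕ) :
    (swapHalves l g)^[r] (half m l true x₀) = half m l (!r.bodd) (chase x₀ g r) := by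
  induction r with
  | zero => rfl
  | succ r ih => rw [Function.iterate_succ_apply', ih, swapHalves_half, Nat.bodd_succ]; rfl

variable {D : ℕ}

def PromptFormat.block (E : PromptFormat (m + m + l) D) (b : Bool) (f : Fin m → Fin m) :
    List (Token D) :=
  (List.ofFn fun i => E.entry (half m l b i) (half m l (!b) (f i))).flatten

theorem PromptFormat.prompt_swapHalves (E : PromptFormat (m + m + l) D)
    (g : Bool → Fin m → Fin m) (x : Fin (m + m + l)) :
    E.prompt (swapHalves l g) x =
      (E.block false (g false) ++ E.block true (g true) ++
        ((List.ofFn fun i => E.entry (Fin.natAdd (m + m) i) (Fin.natAdd (m + m) i)).flatten ++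
          E.query x), E.lastToken x) := by
  have h0 : ∀ i, swapHalves l g (Fin.castAdd l (Fin.castAdd m i)) = half m l true (g false i) :=
    swapHalves_half g false
  have h1 : ∀ i, swapHalves l g (Fin.castAdd l (Fin.natAdd m i)) = half m l false (g true i) :=
    swapHalves_half g true
  have h2 : ∀ i, swapHalves l g (Fin.natAdd (m + m) i) = Fin.natAdd (m + m) i := fun i => by
    simp only [swapHalves, Fin.addCases_right]
  have hadd : ∀ {a b : ℕ} (u : Fin (a + b) → List (Token D)), List.ofFn u =
      (List.ofFn fun i => u (Fin.castAdd b i)) ++ List.ofFn fun j => u (Fin.natAdd a j) :=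
    fun _ => List.ofFn_add
  simp only [PromptFormat.prompt, hadd, List.flatten_append, h0, h1, h2,
    List.append_assoc, PromptFormat.block, half, Bool.not_false, Bool.not_true]

end Embedding

/-! ### From the protocol to the bound on the number of steps -/

theorem SolvesIterated.iterate_eq_of_chain_eq {p n H D d : ℕ} {F : NumberFormat p} {L : Layer H D d}
    {E : PromptFormat n D} {readout : ℕ → Token D → Option (Fin n)} {K R : ℕ}
    (h : SolvesIterated F L E readout K R) {f f' : Fin n → Fin n} {x : Fin n}
    (hc : ∀ t ≤ R, (L.chain F (E.prompt f x) t).2 = (L.chain F (E.prompt f' x) t).2) :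
    f^[K] x = f'^[K] x := by
  obtain ⟨t, ht1, htR, ht, hlt⟩ := h f x
  obtain ⟨t', ht1', htR', ht', hlt'⟩ := h f' x
  rcases lt_trichotomy t t' with h1 | rfl | h1
  · have := hlt' t ht1 h1
    rw [← hc t htR, ht] at this
    cases this
  · rw [hc t htR, ht'] at ht
    exact (Option.some.inj ht).symm
  · have := hlt t' ht1' h1
    rw [hc t' htR', ht'] at this
    cases this

/-- Within the range of parameters in which the memory for `k` passes is small compared to the
domain, a layer needs half as many steps as there are iterations. -/
theorem SolvesIterated.lt_two_mul {p n H D d : ℕ} {F : NumberFormat p} {L : Layer H D d}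
    {E : PromptFormat n D} {readout : ℕ → Token D → Option (Fin n)} {k R : ℕ}
    (h : SolvesIterated F L E readout (k + 1) R) (hn : 6 ≤ n)
    (hk : 4 * ((H * (d + 1) * (p + 1) + 2) * k) ≤ n / 2) : k < 2 * R := by
  by_contra! hR
  obtain ⟨m, l, rfl, hm⟩ : ∃ m l, n = m + m + l ∧ n / 2 = m := ⟨n / 2, n % 2, by omega, rfl⟩
  rw [hm] at hk
  have hm2 : 2 < m := by omega
  let x₀ : Fin m := ⟨0, by omega⟩
  let x := half m l true x₀
  obtain ⟨g, g', hs, hne⟩ := exists_publicState_eq_chase_ne (L.message F E.block) (L.update F)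
    (((List.ofFn fun i => E.entry (Fin.natAdd (m + m) i) (Fin.natAdd (m + m) i)).flatten ++
      E.query x, E.lastToken x), none) x₀ hm2 (card_accumulator_le F) k hk
  have heq := h.iterate_eq_of_chain_eq (f := swapHalves l g) (f' := swapHalves l g') (x := x)
    fun t ht => by
      rw [E.prompt_swapHalves, E.prompt_swapHalves]
      have := hs (2 * t) (by omega)
      obtain ⟨_, -, h1⟩ := L.publicState_eq_chain F E.block _ _ g t
      obtain ⟨_, -, h2⟩ := L.publicState_eq_chain F E.block _ _ g' t
      rw [h1, h2] at this
      exact congrArg (fun s => s.1.2) this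
  rw [iterate_swapHalves, iterate_swapHalves] at heq
  exact hne (half_injective _ heq)

end CoT

theorem theorem2 :
    ∃ c : ℝ, 0 < c ∧
      ∀ n H d p : ℕ, 1 ≤ n → 1 ≤ H → 1 ≤ d → 1 ≤ p →
        ∀ K : ℕ, K = ⌈Real.sqrt ((n : ℝ) / ((H : ℝ) * d * p)) / 100⌉₊ →
          ∀ (D : ℕ) (F : CoT.NumberFormat p) (L : CoT.Layer H D d) (E : CoT.PromptFormat n D)
            (readout : ℕ → CoT.Token D → Option (Fin n)) (R : ℕ),
            CoT.SolvesIterated F L E readout K R →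
              c * Real.sqrt ((n : ℝ) / ((H : ℝ) * d * p)) ≤ (R : ℝ) := by
  -- `1 / 200` combines `s / 100 ≤ K` with `K ≤ 2 * R`.
  refine ⟨1 / 200, by norm_num, fun n H d p hn hH hd hp K hK D F L E readout R hsol => ?_⟩
  have hR : 1 ≤ R := by
    obtain ⟨t, h1, h2, -⟩ := hsol id ⟨0, hn⟩
    exact h1.trans h2
  have hR' : (1 : ℝ) ≤ R := by exact_mod_cast hR
  set s := Real.sqrt ((n : ℝ) / ((H : ℝ) * d * p)) with hs
  rcases lt_or_ge s 3 with hs3 | hs3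
  · linarith
  have hq : 1 ≤ H * d * p := Nat.mul_pos (Nat.mul_pos hH hd) hp
  have hqR : (1 : ℝ) ≤ (H : ℝ) * d * p := by exact_mod_cast hq
  have hns : (n : ℝ) = s ^ 2 * ((H : ℝ) * d * p) := by
    rw [hs, Real.sq_sqrt (by positivity), div_mul_cancel₀ _ (by positivity)]
  have hKpos : 0 < K := by rw [hK, Nat.ceil_pos]; linarith
  obtain ⟨k, rfl⟩ : ∃ k, K = k + 1 := ⟨K - 1, by omega⟩
  have hks : (k : ℝ) < s / 100 := by
    rw [← Nat.lt_ceil, ← hK]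
    exact Nat.lt_succ_self k
  have hsk : s / 100 ≤ k + 1 := by
    have := Nat.le_ceil (s / 100)
    rw [← hK] at this
    exact_mod_cast this
  have hn6 : 6 ≤ n := by
    have : (6 : ℝ) ≤ n := by rw [hns]; nlinarith
    exact_mod_cast this
  have hB : H * (d + 1) * (p + 1) ≤ 4 * (H * d * p) := by
    calc H * (d + 1) * (p + 1) ≤ H * (2 * d) * (2 * p) := by gcongr <;> omega
      _ = _ := by ring
  have hk : 4 * ((H * (d + 1) * (p + 1) + 2) * k) ≤ n / 2 := by
    rw [Nat.le_div_iff_mul_le (by norm_num)]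
    -- With `q = H * d * p`, the left side is at most `48 * q * k`, and `k < s / 100` with `s ≤ s ^
    -- 2` keeps this below `s ^ 2 * q = n`.
    calc 4 * ((H * (d + 1) * (p + 1) + 2) * k) * 2 ≤ 4 * ((6 * (H * d * p)) * k) * 2 := by
          gcongr; omega
      _ ≤ n := by
        have : (4 * ((6 * ((H : ℝ) * d * p)) * k) * 2 : ℝ) ≤ n := by
          rw [hns]
          nlinarith [mul_le_mul_of_nonneg_right hks.le (zero_le_one.trans hqR),
            mul_le_mul_of_nonneg_right (by nlinarith : s ≤ s ^ 2) (zero_le_one.trans hqR)]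
        exact_mod_cast this
  have hlt : k + 1 ≤ 2 * R := hsol.lt_two_mul hn6 hk
  have : (k : ℝ) + 1 ≤ 2 * R := by exact_mod_cast hlt
  linarith
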